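/- Let $F_3$ be the free group on three generators $a,b,c$, let $r = aba^{-1}b^{-1}c$, and let $N \subset F_3$ be the normal closure of $r$. For $w \in N$ define the combinatorial area $A(w)$ as the smallest integer $d \ge 0$ such that $w$ can be written in the form $$w = \prod_{i=1}^{d} g_i\, r^{\varepsilon_i} g_i^{-1}, \qquad g_i \in F_3,\ \varepsilon_i \in \{1,-1\}$$ (the empty product, $d=0$, being the identity), and define the $(a,b)$-length $l(w)$ as the number of occurrences of the symbols $a, a^{-1}, b, b^{-1}$ in a cyclic reduction of $w$. Then $$A(w) \le \tfrac12\, l(w) \qquad \text{for every } w \in N.$$ -/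

import Mathlib

open scoped ENNReal

namespace PuncturedPlane

/-- The free group with three generators. -/
abbrev FreeThree : Type := FreeGroup (Fin 3)

/-- The first generator of the free group. -/
def a : FreeThree := FreeGroup.of 0

/-- The second generator of the free group. -/
def b : FreeThree := FreeGroup.of 1

/-- The third generator of the free group. -/
def c : FreeThree := FreeGroup.of 2

/-- The relator `r = a b a⁻¹ b⁻¹ c`. -/
def r : FreeThree := a * b * a⁻¹ * b⁻¹ * c

/-- The normal closure `N` of `r`. -/
def N : Subgroup FreeThree := Subgroup.normalClosure {r}

/-- `w` is a product of exactly `d` factors, each of the form `g r g⁻¹` or `g r⁻¹ g⁻¹`. -/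
def IsProductOfConjugates (w : FreeThree) (d : ℕ) : Prop :=
  ∃ L : List FreeThree, L.length = d ∧
    (∀ x ∈ L, ∃ g : FreeThree, x = g * r * g⁻¹ ∨ x = g * r⁻¹ * g⁻¹) ∧ w = L.prod

/-- The combinatorial area: the infimum of the number of factors over all decompositions of `w`
into conjugates of `r` and `r⁻¹`; it is `⊤` if there is no such decomposition. -/
noncomputable def area (w : FreeThree) : ℕ∞ :=
  ⨅ (d : ℕ) (_ : IsProductOfConjugates w d), (d : ℕ∞)

/-- The `(a, b)`-length: the number of letters `a`, `a⁻¹`, `b`, `b⁻¹` in the cyclic reduction of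
the reduced word of `w`. A letter is a pair of a generator index and a sign. -/
def abLength (w : FreeThree) : ℕ :=
  (FreeGroup.reduceCyclically w.toWord).countP
    (fun x : Fin 3 × Bool => decide (x.1 = 0 ∨ x.1 = 1))

end PuncturedPlane

/-!
The proof triangulates the pentagons of the presentation complex. Cut the square `a b a⁻¹ b⁻¹`
of the relator (contracting the edge `c`) along a diagonal `e`. After this contraction, the
1-skeleton of its universal cover becomes the Farey graph: the homomorphism `rho : F₃ → SL₂(ℤ)` kills `r`, the
subgroup `⟨c⟩` fixes up to sign the base vertex `(1, 0)`, and in each period of `⟨c⟩` the six edges at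
the base vertex are `e`, `a`, `b⁻¹`, `e⁻¹`, `a⁻¹`, `b`. A word in `N` is therefore a closed path
in the Farey graph, whose number of steps is the number `l` of its `(a, b)`-letters.

A Farey path between adjacent vertices always passes through an end or through the apex of a
triangle on the edge between its ends (`exists_apex`). By induction, a closed path of `l` steps is
filled with at most `l` triangles (`IsPath.near`).

Finally, `e` can be eliminated in two ways: with `e = a b` the triangle `a b e⁻¹` becomes trivial
and the triangle `e a⁻¹ b⁻¹ c` becomes the relator, and with `e = c⁻¹ b a` it is the other way
round. Hence the area is at most the number of triangles of either kind, and the smaller of these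
two numbers is at most `l / 2`. Both eliminations are handled at once by working in `F₃ × F₃`.
The area is invariant under conjugation, so the word may be replaced by its cyclic reduction.
-/

namespace PuncturedPlane

/-! ### Products of conjugates of the relator -/

lemma isProductOfConjugates_one : IsProductOfConjugates 1 0 :=
  ⟨[], rfl, by simp, rfl⟩

lemma isProductOfConjugates_conj_r (g : FreeThree) : IsProductOfConjugates (g * r * g⁻¹) 1 :=
  ⟨[g * r * g⁻¹], rfl, by simpa using ⟨g, Or.inl rfl⟩, by simp⟩

lemma isProductOfConjugates_conj_r_inv (g : FreeThree) :
    IsProductOfConjugates (g * r⁻¹ * g⁻¹) 1 :=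
  ⟨[g * r⁻¹ * g⁻¹], rfl, by simpa using ⟨g, Or.inr rfl⟩, by simp⟩

lemma IsProductOfConjugates.mul {x y : FreeThree} {m n : ℕ} (hx : IsProductOfConjugates x m)
    (hy : IsProductOfConjugates y n) : IsProductOfConjugates (x * y) (m + n) := by
  obtain ⟨L, rfl, hL, rfl⟩ := hx
  obtain ⟨M, rfl, hM, rfl⟩ := hy
  refine ⟨L ++ M, by simp, fun x hx => ?_, by simp⟩
  rcases List.mem_append.1 hx with h | h
  · exact hL x h
  · exact hM x h

lemma IsProductOfConjugates.conj {x : FreeThree} {n : ℕ} (hx : IsProductOfConjugates x n)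
    (g : FreeThree) : IsProductOfConjugates (g * x * g⁻¹) n := by
  obtain ⟨L, rfl, hL, rfl⟩ := hx
  refine ⟨L.map (MulAut.conj g), by simp, fun x hx => ?_, ?_⟩
  · obtain ⟨y, hy, rfl⟩ := List.mem_map.1 hx
    obtain ⟨k, rfl | rfl⟩ := hL y hy
    · exact ⟨g * k, Or.inl (by simp [MulAut.conj_apply, mul_assoc])⟩
    · exact ⟨g * k, Or.inr (by simp [MulAut.conj_apply, mul_assoc])⟩
  · rw [← map_list_prod, MulAut.conj_apply]

lemma IsProductOfConjugates.mem_N {x : FreeThree} {n : ℕ} (hx : IsProductOfConjugates x n) :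
    x ∈ N := by
  obtain ⟨L, rfl, hL, rfl⟩ := hx
  have hr : r ∈ N := Subgroup.subset_normalClosure rfl
  refine Subgroup.list_prod_mem _ fun x hx => ?_
  obtain ⟨k, rfl | rfl⟩ := hL x hx
  · exact Subgroup.normalClosure_normal.conj_mem _ hr _
  · exact Subgroup.normalClosure_normal.conj_mem _ (inv_mem hr) _

/-- `x` and `y` differ in both coordinates by products of conjugates of `r` and `r⁻¹`, with at
most `n` factors in total. -/
def Near (n : ℕ) (x y : FreeThree × FreeThree) : Prop :=
  ∃ p q : ℕ, p + q ≤ n ∧ IsProductOfConjugates (x⁻¹ * y).1 p ∧ IsProductOfConjugates (x⁻¹ * y).2 q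

lemma Near.refl (x : FreeThree × FreeThree) : Near 0 x x :=
  ⟨0, 0, le_rfl, by simpa using isProductOfConjugates_one, by simpa using isProductOfConjugates_one⟩

lemma Near.mono {m n : ℕ} {x y : FreeThree × FreeThree} (h : Near m x y) (hmn : m ≤ n) :
    Near n x y := by
  obtain ⟨p, q, hpq, hp, hq⟩ := h
  exact ⟨p, q, hpq.trans hmn, hp, hq⟩

lemma Near.trans {m n : ℕ} {x y z : FreeThree × FreeThree} (h : Near m x y) (h' : Near n y z) :
    Near (m + n) x z := by
  obtain ⟨p, q, hpq, hp, hq⟩ := h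
  obtain ⟨p', q', hpq', hp', hq'⟩ := h'
  refine ⟨p + p', q + q', by omega, ?_, ?_⟩
  · convert hp.mul hp' using 1
    simp [mul_assoc]
  · convert hq.mul hq' using 1
    simp [mul_assoc]

lemma IsProductOfConjugates.inv {x : FreeThree} {n : ℕ} (hx : IsProductOfConjugates x n) :
    IsProductOfConjugates x⁻¹ n := by
  obtain ⟨L, rfl, hL, rfl⟩ := hx
  refine ⟨(L.map (·⁻¹)).reverse, by simp, fun x hx => ?_, List.prod_inv_reverse L⟩
  obtain ⟨y, hy, rfl⟩ := List.mem_map.1 (List.mem_reverse.1 hx)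
  obtain ⟨k, rfl | rfl⟩ := hL y hy
  · exact ⟨k, Or.inr (by group)⟩
  · exact ⟨k, Or.inl (by group)⟩

lemma Near.symm {n : ℕ} {x y : FreeThree × FreeThree} (h : Near n x y) : Near n y x := by
  obtain ⟨p, q, hpq, hp, hq⟩ := h
  exact ⟨p, q, hpq, by simpa using hp.inv, by simpa using hq.inv⟩

lemma Near.mul_left {n : ℕ} {x y : FreeThree × FreeThree} (h : Near n x y)
    (u : FreeThree × FreeThree) : Near n (u * x) (u * y) := by
  have : (u * x)⁻¹ * (u * y) = x⁻¹ * y := by group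
  simpa only [Near, this] using h

lemma Near.mul_right {n : ℕ} {x y : FreeThree × FreeThree} (h : Near n x y)
    (u : FreeThree × FreeThree) : Near n (x * u) (y * u) := by
  obtain ⟨p, q, hpq, hp, hq⟩ := h
  refine ⟨p, q, hpq, ?_, ?_⟩
  · convert hp.conj u.1⁻¹ using 1
    simp [mul_assoc]
  · convert hq.conj u.2⁻¹ using 1
    simp [mul_assoc]

/-! ### The action on the Farey graph -/

/-- The homomorphism `F₃ → SL₂(ℤ)` that kills `r` and sends `c` to `-T⁶`, where `T` is the
unipotent translation. On `⟨a, b⟩` it lifts the inclusion of the commutator subgroup of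
`PSL₂(ℤ)`, a free group of rank two. -/
def rho : FreeThree →* Matrix.SpecialLinearGroup (Fin 2) ℤ :=
  FreeGroup.lift ![⟨!![1, -5; 1, -4], by simp [Matrix.det_fin_two]⟩,
    ⟨!![-5, 11; -1, 2], by simp [Matrix.det_fin_two]⟩,
    ⟨!![-1, -6; 0, -1], by simp [Matrix.det_fin_two]⟩]

lemma rho_a : (rho a : Matrix (Fin 2) (Fin 2) ℤ) = !![1, -5; 1, -4] := by simp [rho, a]

lemma rho_b : (rho b : Matrix (Fin 2) (Fin 2) ℤ) = !![-5, 11; -1, 2] := by simp [rho, b]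

lemma rho_c : (rho c : Matrix (Fin 2) (Fin 2) ℤ) = !![-1, -6; 0, -1] := by simp [rho, c]

lemma rho_r : rho r = 1 := by
  ext i j
  simp only [r, map_mul, map_inv, Matrix.SpecialLinearGroup.coe_mul,
    Matrix.SpecialLinearGroup.coe_inv, rho_a, rho_b, rho_c, Matrix.adjugate_fin_two_of]
  fin_cases i <;> fin_cases j <;> simp [Matrix.mul_apply, Fin.sum_univ_two]

lemma rho_eq_one_of_mem_N {x : FreeThree} (hx : x ∈ N) : rho x = 1 := by
  have : N ≤ rho.ker := Subgroup.normalClosure_le_normal (by simpa using rho_r)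
  exact this hx

lemma Near.rho_eq {n : ℕ} {x y : FreeThree × FreeThree} (h : Near n x y) :
    rho x.1 = rho y.1 := by
  obtain ⟨p, q, -, hp, -⟩ := h
  have := rho_eq_one_of_mem_N hp.mem_N
  simpa [inv_mul_eq_one] using this

/-- The determinant of the first columns of `rho x.1` and `rho y.1`. These columns, up to sign, are
vertices of the Farey graph; they agree when the determinant is `0` and are adjacent when it
is `±1`. -/
def farey (x y : FreeThree × FreeThree) : ℤ :=
  (rho x.1).1 0 0 * (rho y.1).1 1 0 - (rho x.1).1 1 0 * (rho y.1).1 0 0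

lemma farey_eq (x y : FreeThree × FreeThree) : farey x y = (rho (x⁻¹ * y).1).1 1 0 := by
  simp [farey, Matrix.SpecialLinearGroup.coe_inv, Matrix.adjugate_fin_two, Matrix.mul_apply,
    Fin.sum_univ_two]
  ring

lemma farey_symm (x y : FreeThree × FreeThree) : farey x y = -farey y x := by
  simp only [farey]
  ring

lemma abs_farey_eq_of_farey_eq_zero {x y : FreeThree × FreeThree} (h : farey x y = 0)
    {u : FreeThree × FreeThree} : |farey u x| = |farey u y| := by
  have hy : rho y.1 = rho x.1 * rho (x⁻¹ * y).1 := by simp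
  rw [farey_eq] at h
  have hdet := (rho (x⁻¹ * y).1).2
  rw [Matrix.det_fin_two, h, mul_zero, sub_zero] at hdet
  have h1 : farey u y = farey u x * (rho (x⁻¹ * y).1).1 0 0 := by
    simp only [farey, hy, Matrix.SpecialLinearGroup.coe_mul, Matrix.mul_apply, Fin.sum_univ_two]
    rw [h]
    ring
  rw [h1, abs_mul, Int.isUnit_iff_abs_eq.1 (IsUnit.of_mul_eq_one _ hdet), mul_one]

lemma farey_mul_left (u x y : FreeThree × FreeThree) : farey (u * x) (u * y) = farey x y := by
  rw [farey_eq, farey_eq]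
  group

lemma Near.farey_eq_right {n : ℕ} {x y : FreeThree × FreeThree} (h : Near n x y)
    (u : FreeThree × FreeThree) : farey u x = farey u y := by
  simp only [farey, h.rho_eq]

/-- The letter `c` in both coordinates. -/
def cc : FreeThree × FreeThree := (c, c)

/-- The diagonal of the square `a b a⁻¹ b⁻¹ c`: it is `a b` in the first coordinate and `c⁻¹ b a` in
the second one. Of the two triangles into which it cuts the square, each is a relation in one
coordinate and a conjugate of `r` or `r⁻¹` in the other one. -/
def diag : FreeThree × FreeThree := (a * b, c⁻¹ * b * a)

/-- The six edges at the base vertex in one period of the stabilizer `⟨c⟩`. -/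
def baseEdge (z : ℤ) : FreeThree × FreeThree :=
  if z = 0 then diag else if z = 1 then (a, a) else if z = 2 then (b⁻¹, b⁻¹)
  else if z = 3 then diag⁻¹ else if z = 4 then (a⁻¹, a⁻¹) else (b, b)

/-- The edge that leads from the base vertex `(1, 0)` to its neighbour `(z, 1)`. -/
def edge (z : ℤ) : FreeThree × FreeThree := cc ^ (z / 6) * baseEdge (z % 6)

lemma edge_add (z q : ℤ) : edge (z + 6 * q) = cc ^ q * edge z := by
  simp only [edge, Int.add_mul_emod_self_left, ← mul_assoc, ← zpow_add]
  congr 2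
  omega

lemma rho_cc_zpow (q : ℤ) : ∃ ε : ℤ, ε * ε = 1 ∧
    ((rho (cc ^ q).1).1 : Matrix (Fin 2) (Fin 2) ℤ) = !![ε, ε * (6 * q); 0, ε] := by
  induction q with
  | zero => exact ⟨1, by simp, by simp [Matrix.one_fin_two]⟩
  | succ n ih =>
    obtain ⟨ε, h1, h2⟩ := ih
    refine ⟨-ε, by simpa using h1, ?_⟩
    rw [zpow_add_one, Prod.fst_mul, map_mul, Matrix.SpecialLinearGroup.coe_mul, h2]
    simp only [cc, rho_c]
    ext i j
    fin_cases i <;> fin_cases j <;> simp [Matrix.mul_apply, Fin.sum_univ_two]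
    ring
  | pred n ih =>
    obtain ⟨ε, h1, h2⟩ := ih
    refine ⟨-ε, by simpa using h1, ?_⟩
    rw [zpow_sub_one, Prod.fst_mul, map_mul, Matrix.SpecialLinearGroup.coe_mul, h2]
    simp only [cc, Prod.fst_inv, map_inv, Matrix.SpecialLinearGroup.coe_inv, rho_c,
      Matrix.adjugate_fin_two_of]
    ext i j
    fin_cases i <;> fin_cases j <;> simp [Matrix.mul_apply, Fin.sum_univ_two]
    ring

lemma farey_mul_cc_zpow (x y : FreeThree × FreeThree) (q : ℤ) :
    farey x (y * cc ^ q) = 0 ↔ farey x y = 0 := by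
  obtain ⟨ε, h1, h2⟩ := rho_cc_zpow q
  have hε : ε ≠ 0 := by rintro rfl; simp at h1
  have : farey x (y * cc ^ q) = farey x y * ε := by
    simp only [farey, Prod.fst_mul, map_mul, Matrix.SpecialLinearGroup.coe_mul, h2,
      Matrix.mul_apply, Fin.sum_univ_two]
    simp
    ring
  simp [this, hε]

lemma abs_farey_mul_cc_zpow (x y : FreeThree × FreeThree) (q : ℤ) :
    |farey x (y * cc ^ q)| = |farey x y| := by
  obtain ⟨ε, h1, h2⟩ := rho_cc_zpow q
  have hε : |ε| = 1 := by
    rcases mul_self_eq_one_iff.1 h1 with rfl | rfl <;> simp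
  have : farey x (y * cc ^ q) = farey x y * ε := by
    simp only [farey, Prod.fst_mul, map_mul, Matrix.SpecialLinearGroup.coe_mul, h2,
      Matrix.mul_apply, Fin.sum_univ_two]
    simp
    ring
  rw [this, abs_mul, hε, mul_one]

/-- Modulo `6`, the number of the edge inverse to the edge with number `z`. -/
def opp (z : ℤ) : ℤ := if z % 6 < 3 then z % 6 + 3 else z % 6 - 3

lemma opp_add (z q : ℤ) : opp (z + 6 * q) = opp z := by simp [opp]

lemma exists_residue (z : ℤ) : ∃ s q : ℤ, 0 ≤ s ∧ s < 6 ∧ z = s + 6 * q :=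
  ⟨z % 6, z / 6, by omega, by omega, by omega⟩

lemma rho_edge (z : ℤ) : ∃ ε : ℤ, ε * ε = 1 ∧
    ((rho (edge z).1).1 : Matrix (Fin 2) (Fin 2) ℤ) =
      !![ε * z, ε * (-z * opp z - 1); ε, -ε * opp z] := by
  obtain ⟨s, q, h0, h6, rfl⟩ := exists_residue z
  obtain ⟨ε, h1, h2⟩ := rho_cc_zpow q
  have key : ∃ δ : ℤ, δ * δ = 1 ∧ ((rho (edge s).1).1 : Matrix (Fin 2) (Fin 2) ℤ) =
      !![δ * s, δ * (-s * opp s - 1); δ, -δ * opp s] := by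
    interval_cases s
    on_goal 1 => refine ⟨-1, by norm_num, ?_⟩
    on_goal 2 => refine ⟨1, by norm_num, ?_⟩
    on_goal 3 => refine ⟨1, by norm_num, ?_⟩
    on_goal 4 => refine ⟨1, by norm_num, ?_⟩
    on_goal 5 => refine ⟨-1, by norm_num, ?_⟩
    on_goal 6 => refine ⟨-1, by norm_num, ?_⟩
    all_goals
      simp only [edge, baseEdge, opp]
      norm_num [diag, Matrix.SpecialLinearGroup.coe_inv, rho_a, rho_b, rho_c]
  obtain ⟨δ, h3, h4⟩ := key
  refine ⟨ε * δ, by linear_combination h1 * (δ * δ) + h3, ?_⟩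
  rw [edge_add, Prod.fst_mul, map_mul, Matrix.SpecialLinearGroup.coe_mul, h2, h4, opp_add]
  ext i j
  fin_cases i <;> fin_cases j <;> simp [Matrix.mul_apply, Fin.sum_univ_two] <;> ring

lemma farey_edge_mul_edge (z y : ℤ) : |farey 1 (edge z * edge y)| = |y - opp z| := by
  obtain ⟨ε, h1, h2⟩ := rho_edge z
  obtain ⟨δ, h3, h4⟩ := rho_edge y
  have : farey 1 (edge z * edge y) = ε * δ * (y - opp z) := by
    rw [farey_eq, inv_one, one_mul, Prod.fst_mul, map_mul]
    erw [Matrix.SpecialLinearGroup.coe_mul]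
    rw [h2, h4]
    simp [Matrix.mul_apply, Fin.sum_univ_two]
    ring
  rcases mul_self_eq_one_iff.1 h1 with rfl | rfl <;>
    rcases mul_self_eq_one_iff.1 h3 with rfl | rfl <;> simp [this, abs_sub_comm]

lemma farey_one_edge (z : ℤ) : |farey 1 (edge z)| = 1 := by
  obtain ⟨ε, h1, h2⟩ := rho_edge z
  have : farey 1 (edge z) = ε := by
    rw [farey_eq, inv_one, one_mul, h2]
    simp
  rcases mul_self_eq_one_iff.1 h1 with rfl | rfl <;> simp [this]

lemma edge_mul_edge_opp (z : ℤ) : ∃ i : ℤ, edge z * edge (opp z) = cc ^ i := by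
  obtain ⟨s, q, h0, h6, rfl⟩ := exists_residue z
  refine ⟨q, ?_⟩
  rw [edge_add, opp_add, mul_assoc]
  suffices edge s * edge (opp s) = 1 by rw [this, mul_one]
  interval_cases s <;> norm_num [edge, baseEdge, opp]

lemma near_of_conj_fst {x y : FreeThree × FreeThree} (g : FreeThree) (h2 : x.2 = y.2)
    (h1 : x.1⁻¹ * y.1 = g * r * g⁻¹ ∨ x.1⁻¹ * y.1 = g * r⁻¹ * g⁻¹) : Near 1 x y := by
  refine ⟨1, 0, le_rfl, ?_, by simpa [h2] using isProductOfConjugates_one⟩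
  rcases h1 with h | h
  · simpa [h] using isProductOfConjugates_conj_r g
  · simpa [h] using isProductOfConjugates_conj_r_inv g

lemma near_of_conj_snd {x y : FreeThree × FreeThree} (g : FreeThree) (h1 : x.1 = y.1)
    (h2 : x.2⁻¹ * y.2 = g * r * g⁻¹ ∨ x.2⁻¹ * y.2 = g * r⁻¹ * g⁻¹) : Near 1 x y := by
  refine ⟨0, 1, le_rfl, by simpa [h1] using isProductOfConjugates_one, ?_⟩
  rcases h2 with h | h
  · simpa [h] using isProductOfConjugates_conj_r g
  · simpa [h] using isProductOfConjugates_conj_r_inv g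

/-- The triangle on the lower side of an edge: two consecutive sides can be replaced by the third
one, at the cost of one conjugate of the relator in one of the coordinates. -/
lemma near_edge_sub_one (z : ℤ) :
    ∃ i : ℤ, Near 1 (edge z * edge (opp z + 1)) (edge (z - 1) * cc ^ i) := by
  obtain ⟨s, q, h0, h6, rfl⟩ := exists_residue z
  rw [opp_add, edge_add, show s + 6 * q - 1 = s - 1 + 6 * q by ring, edge_add]
  suffices ∃ i : ℤ, Near 1 (edge s * edge (opp s + 1)) (edge (s - 1) * cc ^ i) by
    obtain ⟨i, hi⟩ := this
    exact ⟨i, by simpa only [mul_assoc] using hi.mul_left (cc ^ q)⟩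
  -- In each case `x⁻¹ * y` is a cyclic rotation of `r⁻¹` in one coordinate, which determines the
  -- conjugator, and trivial in the other one.
  interval_cases s
  on_goal 1 => refine ⟨0, near_of_conj_fst (a * b⁻¹ * a⁻¹) ?_ (Or.inr ?_)⟩
  on_goal 3 => refine ⟨0, near_of_conj_snd (b⁻¹ * a⁻¹) ?_ (Or.inr ?_)⟩
  on_goal 5 => refine ⟨0, near_of_conj_fst (b⁻¹ * a⁻¹) ?_ (Or.inr ?_)⟩
  on_goal 7 => refine ⟨0, near_of_conj_snd a⁻¹ ?_ (Or.inr ?_)⟩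
  on_goal 9 => refine ⟨-1, near_of_conj_fst c ?_ (Or.inr ?_)⟩
  on_goal 11 => refine ⟨0, near_of_conj_snd 1 ?_ (Or.inr ?_)⟩
  all_goals norm_num [edge, baseEdge, opp, diag, cc, r, mul_assoc]

/-- The triangle on the upper side of an edge; compare `near_edge_sub_one`. -/
lemma near_edge_add_one (z : ℤ) :
    ∃ i : ℤ, Near 1 (edge z * edge (opp z - 1)) (edge (z + 1) * cc ^ i) := by
  obtain ⟨s, q, h0, h6, rfl⟩ := exists_residue z
  rw [opp_add, edge_add, show s + 6 * q + 1 = s + 1 + 6 * q by ring, edge_add]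
  suffices ∃ i : ℤ, Near 1 (edge s * edge (opp s - 1)) (edge (s + 1) * cc ^ i) by
    obtain ⟨i, hi⟩ := this
    exact ⟨i, by simpa only [mul_assoc] using hi.mul_left (cc ^ q)⟩
  interval_cases s
  on_goal 1 => refine ⟨0, near_of_conj_snd a⁻¹ ?_ (Or.inl ?_)⟩
  on_goal 3 => refine ⟨1, near_of_conj_fst 1 ?_ (Or.inl ?_)⟩
  on_goal 5 => refine ⟨0, near_of_conj_snd 1 ?_ (Or.inl ?_)⟩
  on_goal 7 => refine ⟨0, near_of_conj_fst (b⁻¹ * c) ?_ (Or.inl ?_)⟩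
  on_goal 9 => refine ⟨0, near_of_conj_snd (a⁻¹ * b⁻¹ * c) ?_ (Or.inl ?_)⟩
  on_goal 11 => refine ⟨0, near_of_conj_fst (a⁻¹ * b⁻¹ * c) ?_ (Or.inl ?_)⟩
  all_goals norm_num [edge, baseEdge, opp, diag, cc, r, mul_assoc]

/-! ### Closed paths in the Farey graph -/

lemma abs_lt_abs_of_abs_det_eq_one {x y x' y' : ℤ} (hdet : |x * y' - y * x'| = 1)
    (h : |y| < |x|) (h' : 1 < |x'| ∨ 1 < |y'|) : |y'| < |x'| := by
  by_contra! hle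
  have h2 : 2 ≤ |y'| := by omega
  have h3 : |x| * |y'| ≤ 1 + |y| * |x'| := by
    rw [← abs_mul, ← abs_mul, ← hdet]
    have := abs_add_le (x * y' - y * x') (y * x')
    simpa using this
  nlinarith [abs_nonneg y]

/-- A Farey path of length at least `2` whose ends are adjacent passes through one of the ends or
through the apex of one of the two triangles on the edge between its ends. In the basis of the
ends, a path that avoids these vertices cannot leave the region `|y| < |x|` around its start.
Here `D i j` stands for the determinant of the `i`-th and `j`-th vertex, and `hD` is the Plücker
relation. -/
lemma exists_apex (D : ℕ → ℕ → ℤ) (hD : ∀ i j k l, D k l * D i j = D k i * D l j - D k j * D l i)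
    (hself : ∀ i, D i i = 0) (hsymm : ∀ i j, D i j = -D j i)
    {k n : ℕ} (hn : 2 ≤ n) (hstep : ∀ i, k ≤ i → i < k + n → |D i (i + 1)| = 1)
    (hend : |D k (k + n)| = 1) :
    ∃ j, k < j ∧ j < k + n ∧ |D k j| ≤ 1 ∧ |D j (k + n)| ≤ 1 := by
  by_contra! hcon
  have key : ∀ m, m < n → |D k (k + m)| < |D (k + m) (k + n)| := by
    intro m
    induction m with
    | zero => intro _; simp [hself, hend]
    | succ m ih =>
      intro hm
      refine abs_lt_abs_of_abs_det_eq_one (x := D (k + m) (k + n)) (y := D k (k + m)) ?_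
        (ih (by omega)) ?_
      · have h1 := hD (k + m) (k + (m + 1)) k (k + n)
        have h2 := hstep (k + m) (by omega) (by omega)
        rw [hsymm (k + n) (k + (m + 1)), hsymm (k + n) (k + m)] at h1
        have h3 : D (k + m) (k + n) * D k (k + (m + 1)) - D k (k + m) * D (k + (m + 1)) (k + n)
            = D k (k + n) * D (k + m) (k + (m + 1)) := by rw [h1]; ring
        rw [h3, abs_mul, hend, one_mul]
        exact h2
      · by_contra! h
        have := hcon (k + (m + 1)) (by omega) (by omega) h.2
        omega
  have h1 := key (n - 1) (by omega)
  have h2 := hstep (k + (n - 1)) (by omega) (by omega)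
  rw [show k + (n - 1) + 1 = k + n by omega] at h2
  have h3 := hcon (k + (n - 1)) (by omega) (by omega) (by omega)
  omega

/-- A sequence of `m` steps along the edges of the Farey graph. -/
def IsPath (m : ℕ) (g : ℕ → FreeThree × FreeThree) : Prop :=
  ∀ k < m, ∃ z j : ℤ, g (k + 1) = g k * (edge z * cc ^ j)

lemma cc_zpow_mul_edge (i z : ℤ) : cc ^ i * edge z = edge (z + 6 * i) := (edge_add z i).symm

/-- Triangulating the polygon between a path and the edge that joins its ends, or between a closed
path and its base vertex. -/
lemma IsPath.near {m : ℕ} {g : ℕ → FreeThree × FreeThree} (hg : IsPath m g) (n : ℕ) :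
    ∀ k, k + n ≤ m →
      (|farey (g k) (g (k + n))| = 1 → ∃ z j : ℤ,
        Near (n - 1) (g k * (edge z * cc ^ j)) (g (k + n))) ∧
      (farey (g k) (g (k + n)) = 0 → ∃ j : ℤ, Near n (g k * cc ^ j) (g (k + n))) := by
  induction n using Nat.strong_induction_on with
  | _ n ih =>
  intro k hk
  constructor
  · intro hend
    obtain rfl | rfl | hn : n = 0 ∨ n = 1 ∨ 2 ≤ n := by omega
    · simp [farey, mul_comm] at hend
    · obtain ⟨z, j, h⟩ := hg k (by omega)
      exact ⟨z, j, by rw [h]; exact Near.refl _⟩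
    obtain ⟨j, hkj, hjn, h1, h2⟩ := exists_apex (fun i j => farey (g i) (g j))
      (fun i j k l => by simp only [farey]; ring) (fun i => by simp only [farey]; ring)
      (fun i j => by simp only [farey]; ring) hn
      (fun i hi hin => by
        obtain ⟨z, j, h⟩ := hg i (by omega)
        have := farey_mul_left (g i) 1 (edge z * cc ^ j)
        rw [mul_one] at this
        simp only [h, this, abs_farey_mul_cc_zpow, farey_one_edge]) hend
    obtain ⟨p, rfl⟩ : ∃ p, j = k + p := ⟨j - k, by omega⟩
    obtain ⟨q, rfl⟩ : ∃ q, n = p + q := ⟨n - p, by omega⟩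
    rw [← add_assoc] at *
    obtain ⟨ih1, ih1'⟩ := ih p (by omega) k (by omega)
    obtain ⟨ih2, ih2'⟩ := ih q (by omega) (k + p) (by omega)
    by_cases h3 : farey (g k) (g (k + p)) = 0
    · obtain ⟨i, hi⟩ := ih1' h3
      by_cases h4 : farey (g (k + p)) (g (k + p + q)) = 0
      · simp [← abs_farey_eq_of_farey_eq_zero h4, h3] at hend
      · obtain ⟨z, j, hz⟩ := ih2 (by have := abs_pos.2 h4; omega)
        refine ⟨z + 6 * i, j, ?_⟩
        have := (hi.mul_right (edge z * cc ^ j)).trans hz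
        rw [← cc_zpow_mul_edge]
        simp only [mul_assoc] at this ⊢
        exact this.mono (by omega)
    · obtain ⟨z, j, hz⟩ := ih1 (by have := abs_pos.2 h3; omega)
      by_cases h4 : farey (g (k + p)) (g (k + p + q)) = 0
      · obtain ⟨i', hi'⟩ := ih2' h4
        refine ⟨z, j + i', ?_⟩
        have := (hz.mul_right (cc ^ i')).trans hi'
        rw [zpow_add]
        simp only [mul_assoc] at this ⊢
        exact this.mono (by omega)
      · obtain ⟨y, i, hy⟩ := ih2 (by have := abs_pos.2 h4; omega)
        have h5 := (hz.mul_right (edge y * cc ^ i)).trans hy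
        have h6 : g k * (edge z * cc ^ j) * (edge y * cc ^ i)
            = g k * (edge z * edge (y + 6 * j)) * cc ^ i := by
          rw [← cc_zpow_mul_edge]
          simp only [mul_assoc]
        rw [h6] at h5
        have h7 : |y + 6 * j - opp z| = 1 := by
          have := farey_mul_left (g k) 1 (edge z * edge (y + 6 * j))
          rw [mul_one] at this
          rwa [← h5.farey_eq_right, abs_farey_mul_cc_zpow, this, farey_edge_mul_edge] at hend
        have h8 : ∃ z' i' : ℤ, Near 1 (edge z * edge (y + 6 * j)) (edge z' * cc ^ i') := by
          rcases abs_eq (zero_le_one) |>.1 h7 with h | h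
          · rw [show y + 6 * j = opp z + 1 by omega]
            exact ⟨z - 1, near_edge_sub_one z⟩
          · rw [show y + 6 * j = opp z - 1 by omega]
            exact ⟨z + 1, near_edge_add_one z⟩
        obtain ⟨z', i', h8⟩ := h8
        refine ⟨z', i' + i, ?_⟩
        have h9 := ((h8.mul_left (g k)).symm.mul_right (cc ^ i)).trans h5
        rw [zpow_add]
        simp only [mul_assoc] at h9 ⊢
        exact h9.mono (by omega)
  · intro hend
    obtain rfl | hn := Nat.eq_zero_or_pos n
    · exact ⟨0, by simpa using Near.refl _⟩
    obtain ⟨n, rfl⟩ : ∃ n', n = n' + 1 := ⟨n - 1, by omega⟩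
    obtain ⟨z, j, hz⟩ := hg k (by omega)
    have h1 : |farey (g (k + 1)) (g (k + 1 + n))| = 1 := by
      rw [show k + 1 + n = k + (n + 1) by omega, ← abs_farey_eq_of_farey_eq_zero hend,
        farey_symm, abs_neg, hz]
      have := farey_mul_left (g k) 1 (edge z * cc ^ j)
      rw [mul_one] at this
      rw [this, abs_farey_mul_cc_zpow, farey_one_edge]
    obtain ⟨y, i, hy⟩ := (ih n (by omega) (k + 1) (by omega)).1 h1
    have h2 : g (k + 1) * (edge y * cc ^ i) = g k * (edge z * edge (y + 6 * j)) * cc ^ i := by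
      rw [hz, ← cc_zpow_mul_edge]
      simp only [mul_assoc]
    rw [h2, show k + 1 + n = k + (n + 1) by omega] at hy
    have h3 : |y + 6 * j - opp z| = 0 := by
      have := farey_mul_left (g k) 1 (edge z * edge (y + 6 * j))
      rw [mul_one] at this
      rwa [← hy.farey_eq_right, farey_mul_cc_zpow, this, ← abs_eq_zero, farey_edge_mul_edge]
        at hend
    obtain ⟨t, ht⟩ := edge_mul_edge_opp z
    rw [show y + 6 * j = opp z by have := abs_eq_zero.1 h3; omega, ht, mul_assoc, ← zpow_add] at hy
    exact ⟨t + i, hy.mono (by omega)⟩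

/-! ### Words as paths -/

/-- The `(a, b)`-letters of a word are the steps of a path from the base vertex; the letters
`c` and `c⁻¹` fix the base vertex. -/
lemma exists_isPath (L : List (Fin 3 × Bool)) : ∃ g : ℕ → FreeThree × FreeThree,
    g 0 = 1 ∧ IsPath (L.countP fun x => decide (x.1 = 0 ∨ x.1 = 1)) g ∧
    ∃ i : ℤ, g (L.countP fun x => decide (x.1 = 0 ∨ x.1 = 1)) * cc ^ i =
      (FreeGroup.mk L, FreeGroup.mk L) := by
  induction L using List.reverseRecOn with
  | nil => exact ⟨fun _ => 1, rfl, fun k hk => by simp at hk, 0, by simp [← FreeGroup.one_eq_mk, Prod.one_eq_mk]⟩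
  | append_singleton L x ih =>
    obtain ⟨g, h0, hg, i, hi⟩ := ih
    have hmk : (FreeGroup.mk (L ++ [x]), FreeGroup.mk (L ++ [x])) =
        (FreeGroup.mk L, FreeGroup.mk L) * (FreeGroup.mk [x], FreeGroup.mk [x]) := by
      simp [FreeGroup.mul_mk]
    rw [List.countP_append, hmk, ← hi]
    generalize (L.countP fun x => decide (x.1 = 0 ∨ x.1 = 1)) = m at *
    have hletter : (x.1 = 2 ∧ ∃ j : ℤ, (FreeGroup.mk [x], FreeGroup.mk [x]) = cc ^ j) ∨
        ((x.1 = 0 ∨ x.1 = 1) ∧ ∃ z : ℤ, (FreeGroup.mk [x], FreeGroup.mk [x]) = edge z) := by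
      obtain ⟨y, s⟩ := x
      have hinv : FreeGroup.mk [(y, false)] = (FreeGroup.of y)⁻¹ := rfl
      have hof : FreeGroup.mk [(y, true)] = FreeGroup.of y := rfl
      cases s
      · rw [hinv]
        fin_cases y
        · exact Or.inr ⟨by simp, 4, by norm_num [edge, baseEdge, a]⟩
        · exact Or.inr ⟨by simp, 2, by norm_num [edge, baseEdge, b]⟩
        · exact Or.inl ⟨by simp, -1, by simp [cc, c]⟩
      · rw [hof]
        fin_cases y
        · exact Or.inr ⟨by simp, 1, by norm_num [edge, baseEdge, a]⟩
        · exact Or.inr ⟨by simp, 5, by norm_num [edge, baseEdge, b]⟩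
        · exact Or.inl ⟨by simp, 1, by simp [cc, c]⟩
    rcases hletter with ⟨hx, j, hj⟩ | ⟨hx, z, hz⟩
    · refine ⟨g, h0, by simpa [hx] using hg, i + j, ?_⟩
      simp [hx, hj, zpow_add, mul_assoc]
    · refine ⟨fun k => if k ≤ m then g k else g m * (edge (z + 6 * i) * cc ^ (0 : ℤ)),
        by simp [h0], ?_, 0, ?_⟩
      · intro k hk
        have hk' : k < m + 1 := by simpa [hx] using hk
        obtain rfl | hlt : k = m ∨ k < m := by omega
        · exact ⟨z + 6 * i, 0, by simp⟩
        · obtain ⟨z', j', h⟩ := hg k hlt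
          refine ⟨z', j', ?_⟩
          simpa [hlt.le, Nat.succ_le_of_lt hlt] using h
      · simp [hx, hz, ← cc_zpow_mul_edge, mul_assoc]

lemma near_one_of_mem_N {L : List (Fin 3 × Bool)} (hL : FreeGroup.mk L ∈ N) :
    Near (L.countP fun x => decide (x.1 = 0 ∨ x.1 = 1)) 1 (FreeGroup.mk L, FreeGroup.mk L) := by
  obtain ⟨g, h0, hg, i, hi⟩ := exists_isPath L
  generalize (L.countP fun x => decide (x.1 = 0 ∨ x.1 = 1)) = m at *
  have hrho := rho_eq_one_of_mem_N hL
  have hclosed : farey (g 0) (g (0 + m)) = 0 := by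
    rw [zero_add, ← farey_mul_cc_zpow _ _ i, hi, h0]
    simp [farey, hrho]
  obtain ⟨j, hj⟩ := (hg.near m 0 (by omega)).2 hclosed
  rw [h0, one_mul, zero_add] at hj
  have hnear := hj.mul_right (cc ^ i)
  rw [hi, ← zpow_add] at hnear
  -- A power of `c` that lies in `N` is trivial, since `rho c` has infinite order.
  have hji : j + i = 0 := by
    obtain ⟨ε, h1, h2⟩ := rho_cc_zpow (j + i)
    have h3 := hnear.rho_eq
    rw [hrho] at h3
    rw [h3] at h2
    have h4 := congrFun (congrFun h2 0) 1
    have hε : ε ≠ 0 := by rintro rfl; simp at h1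
    simpa [hε] using h4
  simpa [hji] using hnear

lemma exists_isProductOfConjugates_mk {L : List (Fin 3 × Bool)} (hL : FreeGroup.mk L ∈ N) :
    ∃ p, IsProductOfConjugates (FreeGroup.mk L) p ∧
      2 * p ≤ L.countP fun x => decide (x.1 = 0 ∨ x.1 = 1) := by
  obtain ⟨p, q, hpq, hp, hq⟩ := near_one_of_mem_N hL
  rw [inv_one, one_mul] at hp hq
  rcases le_total p q with h | h
  · exact ⟨p, hp, by omega⟩
  · exact ⟨q, hq, by omega⟩

lemma exists_isProductOfConjugates {w : FreeThree} (hw : w ∈ N) :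
    ∃ p, IsProductOfConjugates w p ∧ 2 * p ≤ abLength w := by
  set g := FreeGroup.mk (FreeGroup.reduceCyclically.conjugator w.toWord)
  set v := FreeGroup.mk (FreeGroup.reduceCyclically w.toWord)
  have hconj : w = g * v * g⁻¹ := by
    rw [FreeGroup.inv_mk, FreeGroup.mul_mk, FreeGroup.mul_mk,
      FreeGroup.reduceCyclically.conj_conjugator_reduceCyclically, FreeGroup.mk_toWord]
  have hvN : v ∈ N := by
    have := Subgroup.normalClosure_normal.conj_mem w hw g⁻¹
    rwa [hconj, show g⁻¹ * (g * v * g⁻¹) * g⁻¹⁻¹ = v by group] at this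
  obtain ⟨p, hp, hle⟩ := exists_isProductOfConjugates_mk hvN
  exact ⟨p, hconj ▸ hp.conj g, hle⟩

end PuncturedPlane

theorem mainTheorem2 (w : PuncturedPlane.FreeThree) (hw : w ∈ PuncturedPlane.N) :
    (PuncturedPlane.area w : ℝ≥0∞) ≤ (1 / 2 : ℝ≥0∞) * (PuncturedPlane.abLength w : ℝ≥0∞) := by
  obtain ⟨p, hp, hle⟩ := PuncturedPlane.exists_isProductOfConjugates hw
  have h1 : (PuncturedPlane.area w : ℝ≥0∞) ≤ (p : ℝ≥0∞) := by
    have : PuncturedPlane.area w ≤ (p : ℕ∞) := iInf₂_le p hp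
    simpa using ENat.toENNReal_mono this
  have h2 : (2 : ℝ≥0∞) * p ≤ PuncturedPlane.abLength w := by exact_mod_cast hle
  calc (PuncturedPlane.area w : ℝ≥0∞) ≤ p := h1
    _ = (1 / 2 : ℝ≥0∞) * (2 * p) := by
      rw [← mul_assoc, one_div, ENNReal.inv_mul_cancel two_ne_zero ENNReal.ofNat_ne_top, one_mul]
    _ ≤ _ := by gcongr
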